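/- Let $M$ be a compact connected 3-manifold (possibly with boundary) with a triangulation $\mathcal{T}=\{V,E,F,T\}$, i.e. a homeomorphism onto $M$ from the geometric realization of a finite simplicial complex consisting of tetrahedra together with their faces, edges and vertices; let $N=|V|$ and let $\alpha\in\mathbb{R}$. Let $$\mathfrak{M}_{\mathcal{T}}=\Big\{r\in\mathbb{R}_{>0}^{V}\ :\ \Big(\tfrac1{r_i}+\tfrac1{r_j}+\tfrac1{r_k}+\tfrac1{r_l}\Big)^2-2\Big(\tfrac1{r_i^2}+\tfrac1{r_j^2}+\tfrac1{r_k^2}+\tfrac1{r_l^2}\Big)>0\ \text{ for all }\{i,j,k,l\}\in T\Big\}$$ be the space of sphere packing metrics. For $r\in\mathfrak{M}_{\mathcal{T}}$, realize each $\{i,j,k,l\}\in T$ as a Euclidean tetrahedron with edge lengths $l_{ij}=r_i+r_j$; let $\alpha_{ijkl}$ be its solid angle at $i$ (the sum of the dihedral angles along the three edges at $i$, minus $\pi$), and put $$K_i=4\pi-\sum_{\{i,j,k,l\}\in T}\alpha_{ijkl},\qquad R_{\alpha,i}=\frac{K_i}{r_i^{\alpha}},\qquad s_\alpha=\frac{\sum_{i}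 K_ir_i}{\sum_{i} r_i^{\alpha+1}}.$$ Let $\Delta_\alpha$ be the linear operator on functions $f:V\to\mathbb{R}$ given by $$(\Delta_\alpha f)_i=\frac1{r_i^{\alpha}}\sum_{j\sim i}\Big(-\frac{\partial K_i}{\partial r_j}r_j\Big)(f_j-f_i),$$ where $j\sim i$ means $\{i,j\}\in E$, and let $\lambda_1(-\Delta_\alpha)$ be the smallest positive eigenvalue of $-\Delta_\alpha$. A metric $r\in\mathfrak{M}_{\mathcal{T}}$ has constant $\alpha$-curvature if $R_{\alpha,i}$ does not depend on $i$. Let $\mathbb{S}^{N-1}=\{r\in\mathbb{R}^V:\sum_i r_i^2=1\}$, and let $\mathcal{C}_\alpha\subset\mathfrak{M}_{\mathcal{T}}\cap\mathbb{S}^{N-1}$ be the set of all constant $\alpha$-curvature metrics in $\mathfrak{M}_{\mathcal{T}}\cap\mathbb{S}^{N-1}$. Then every $r\in\mathcal{C}_\alpha$ satisfying $\lambda_1(-\Delta_\alpha)>\alpha s_\alpha$ (both evaluated at $r$) is an isolated point of $\mathcal{C}_\alpha$. In particular, every $r\in\mathcal{C}_\alpha$ with $\alpha s_\alpha\le 0$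 is an isolated point of $\mathcal{C}_\alpha$. -/

import Mathlib

open scoped BigOperators Topology

namespace SpherePacking

/-- The geometric realization of a finite abstract simplicial complex in barycentric coordinates:
the points of the standard simplex on the vertex set whose support lies in a face. -/
def realization {V : Type*} [Fintype V] (K : AbstractSimplicialComplex V) : Set (V → ℝ) :=
  {x | x ∈ stdSimplex ℝ V ∧ ∃ s ∈ K.faces, ∀ v, v ∉ s → x v = 0}

/-- A triangulation `{V, E, F, T}` of a compact 3-manifold `M`: a finite simplicial complex with
vertex set `V`, consisting of tetrahedra together with their faces, edges and vertices, and a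
homeomorphism from its geometric realization onto `M`. -/
structure Triangulation (V : Type*) [Fintype V] (M : Type*) [TopologicalSpace M] extends
    AbstractSimplicialComplex V where
  /-- every simplex is a face of a tetrahedron (so there are no simplices of dimension above 3) -/
  subset_tetrahedron : ∀ s ∈ faces, ∃ t ∈ faces, s ⊆ t ∧ t.card = 4
  /-- the realization is homeomorphic to the manifold -/
  homeo : realization toAbstractSimplicialComplex ≃ₜ M

/-- `t` is (the vertex set of) a tetrahedron of the triangulation. -/
def Triangulation.IsTetrahedron {V : Type*} [Fintype V] {M : Type*} [TopologicalSpace M]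
    (T : Triangulation V M) (t : Finset V) : Prop :=
  t ∈ T.faces ∧ t.card = 4

/-- `i ∼ j`: the distinct vertices `i` and `j` span an edge. -/
def Triangulation.Adjacent {V : Type*} [Fintype V] [DecidableEq V] {M : Type*}
    [TopologicalSpace M] (T : Triangulation V M) (i j : V) : Prop :=
  i ≠ j ∧ ({i, j} : Finset V) ∈ T.faces

/-- The quantity `Q` of a tetrahedron `t` with radii `r`. -/
noncomputable def nondegeneracy {V : Type*} (r : V → ℝ) (t : Finset V) : ℝ :=
  (∑ v ∈ t, 1 / r v) ^ 2 - 2 * ∑ v ∈ t, 1 / r v ^ 2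

/-- The space of admissible Euclidean sphere packing metrics. -/
def admissible {V : Type*} [Fintype V] {M : Type*} [TopologicalSpace M]
    (T : Triangulation V M) : Set (V → ℝ) :=
  {r | (∀ v, 0 < r v) ∧ ∀ t, T.IsTetrahedron t → 0 < nondegeneracy r t}

/-- The length of the edge `{i, j}`. -/
def edgeLength {V : Type*} (r : V → ℝ) (i j : V) : ℝ := r i + r j

/-- The inner angle at `i` of the Euclidean triangle `{i, j, k}` (law of cosines). -/
noncomputable def faceAngle {V : Type*} (r : V → ℝ) (i j k : V) : ℝ :=
  Real.arccos ((edgeLength r i j ^ 2 + edgeLength r i k ^ 2 - edgeLength r j k ^ 2) /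
    (2 * edgeLength r i j * edgeLength r i k))

/-- The dihedral angle along the edge `{i, j}` of the Euclidean tetrahedron `{i, j, k, l}`
(spherical law of cosines in the link of the vertex `i`). -/
noncomputable def dihedralAngle {V : Type*} (r : V → ℝ) (i j k l : V) : ℝ :=
  Real.arccos ((Real.cos (faceAngle r i k l) -
      Real.cos (faceAngle r i j k) * Real.cos (faceAngle r i j l)) /
    (Real.sin (faceAngle r i j k) * Real.sin (faceAngle r i j l)))

/-- The solid angle at `i` of the Euclidean tetrahedron `{i, j, k, l}`: the area of the spherical
triangle cut out at `i`, that is, the excess over `π` of the sum of its angles, which are the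
dihedral angles along the three edges at `i`. -/
noncomputable def solidAngle {V : Type*} (r : V → ℝ) (i j k l : V) : ℝ :=
  dihedralAngle r i j k l + dihedralAngle r i k j l + dihedralAngle r i l j k - Real.pi

open Classical in
/-- The combinatorial scalar curvature `K i`: `4 π` minus the solid angles at `i` of the
tetrahedra containing `i`. The sum runs over the ordered triples `(j, k, l)` for which
`{i, j, k, l}` is a tetrahedron; each tetrahedron occurs `6` times, with the same solid angle. -/
noncomputable def curvature {V : Type*} [Fintype V] [DecidableEq V] {M : Type*}
    [TopologicalSpace M] (T : Triangulation V M) (r : V → ℝ) (i : V) : ℝ :=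
  4 * Real.pi - (∑ j, ∑ k, ∑ l,
    if T.IsTetrahedron {i, j, k, l} then solidAngle r i j k l else 0) / 6

/-- The `α`-curvature `R i = K i / r i ^ α`. -/
noncomputable def alphaCurvature {V : Type*} [Fintype V] [DecidableEq V] {M : Type*}
    [TopologicalSpace M] (T : Triangulation V M) (α : ℝ) (r : V → ℝ) (i : V) : ℝ :=
  curvature T r i / r i ^ α

/-- The set of admissible metrics of constant `α`-curvature. -/
def constantAlphaCurvature {V : Type*} [Fintype V] [DecidableEq V] {M : Type*}
    [TopologicalSpace M] (T : Triangulation V M) (α : ℝ) : Set (V → ℝ) :=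
  {r | r ∈ admissible T ∧ ∃ c : ℝ, ∀ i, alphaCurvature T α r i = c}

/-- The Einstein-Hilbert-Regge functional `∑ K i r i`. -/
noncomputable def reggeFunctional {V : Type*} [Fintype V] [DecidableEq V] {M : Type*}
    [TopologicalSpace M] (T : Triangulation V M) (r : V → ℝ) : ℝ :=
  ∑ i, curvature T r i * r i

/-- `s_α = (∑ K i r i) / ∑ r i ^ (α + 1)`. -/
noncomputable def sAlpha {V : Type*} [Fintype V] [DecidableEq V] {M : Type*}
    [TopologicalSpace M] (T : Triangulation V M) (α : ℝ) (r : V → ℝ) : ℝ :=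
  reggeFunctional T r / ∑ i, r i ^ (α + 1)

/-- The partial derivative `∂ K i / ∂ r j` at `r`. -/
noncomputable def curvatureDeriv {V : Type*} [Fintype V] [DecidableEq V] {M : Type*}
    [TopologicalSpace M] (T : Triangulation V M) (r : V → ℝ) (i j : V) : ℝ :=
  deriv (fun x => curvature T (Function.update r j x) i) (r j)

open Classical in
/-- The `α`-Laplacian at the metric `r`:
`(Δ f) i = r i ^ (-α) * ∑_{j ∼ i} (- ∂ K i / ∂ r j * r j) * (f j - f i)`. -/
noncomputable def alphaLaplacian {V : Type*} [Fintype V] [DecidableEq V] {M : Type*}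
    [TopologicalSpace M] (T : Triangulation V M) (α : ℝ) (r : V → ℝ) :
    (V → ℝ) →ₗ[ℝ] (V → ℝ) where
  toFun f i := 1 / r i ^ α *
    ∑ j ∈ Finset.univ.filter (fun j => T.Adjacent i j),
      (-(curvatureDeriv T r i j) * r j) * (f j - f i)
  map_add' f g := by
    funext i
    simp only [Pi.add_apply, ← mul_add, ← Finset.sum_add_distrib]
    congr 1
    exact Finset.sum_congr rfl fun j _ => by ring
  map_smul' c f := by
    funext i
    simp only [Pi.smul_apply, smul_eq_mul, RingHom.id_apply, Finset.mul_sum]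
    exact Finset.sum_congr rfl fun j _ => by ring

/-- `λ₁(-Δ_α)`: the first (smallest) positive eigenvalue of `-Δ_α` at the metric `r`. -/
noncomputable def lambdaOne {V : Type*} [Fintype V] [DecidableEq V] {M : Type*}
    [TopologicalSpace M] (T : Triangulation V M) (α : ℝ) (r : V → ℝ) : ℝ :=
  sInf {μ : ℝ | 0 < μ ∧ Module.End.HasEigenvalue (-(alphaLaplacian T α r)) μ}

/-- The Euclidean unit sphere `𝕊^{N-1}` of `ℝ^V`, where `N` is the number of vertices. -/
def unitSphere (V : Type*) [Fintype V] : Set (V → ℝ) := {r | ∑ v, r v ^ 2 = 1}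

/-- `x` is an isolated point of the set `A`. -/
def IsIsolatedIn {X : Type*} [TopologicalSpace X] (x : X) (A : Set X) : Prop :=
  ∃ U ∈ 𝓝 x, U ∩ A = {x}

end SpherePacking

/-! In the variables f_i = v_i / r_i the differential of the curvature is a weighted graph
Laplacian: r_i dK_i(v) = ∑_j w_ij (f_i - f_j), with w symmetric and supported on edges. Hence -Δ_α
is self-adjoint for the masses r_i^(α+1), and its quadratic form is the Dirichlet energy of w.
Single weights can be negative, so nonnegativity of the energy is proved one tetrahedron at a time:
`tetEnergy_eq` splits the energy into a form vanishing only on constants and a nonnegative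
remainder. Connectedness of M then makes constants the only functions of zero energy, and the
spectral theorem gives the Rayleigh bound `sInf_eigenvalue_mul_le_energy`.

The metrics in question are the solutions (r, c) of K_i = c r_i^α, ∑ r_i² = 1, and there c = s_α. If
v lies in the kernel of the linearized system, f minus its weighted mean has energy exactly α s_α
times its weighted square norm. Either hypothesis of the theorem, through `SpectralGap`, makes f
constant; so v is a multiple of r, and tangency to the sphere makes it zero
(`linearized_injective`). An injective derivative isolates the solution (r, c), and c varies
continuously with the metric, so r itself is isolated. -/

namespace SpherePacking

/-! ### Angles of a sphere-packed tetrahedron in reciprocal radii -/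

/-- Derivative of `arccos (N / (2 √P))` when `4 P - N ^ 2` is a perfect square. -/
lemma hasFDerivAt_arccos_div_two_sqrt {E : Type*} [NormedAddCommGroup E] [NormedSpace ℝ E]
    {N P : E → ℝ} {N' P' : E →L[ℝ] ℝ} {x : E} {W : ℝ}
    (hN : HasFDerivAt N N' x) (hP : HasFDerivAt P P' x) (hP0 : 0 < P x) (hW : 0 < W)
    (h : 4 * P x - N x ^ 2 = W ^ 2) :
    HasFDerivAt (fun y => Real.arccos (N y / (2 * √(P y))))
      ((-(1 / (2 * P x * W))) • ((2 * P x) • N' - N x • P')) x := by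
  have hs : 0 < √(P x) := Real.sqrt_pos.2 hP0
  have hsq : √(P x) ^ 2 = P x := Real.sq_sqrt hP0.le
  have key : 1 - (N x / (2 * √(P x))) ^ 2 = (W / (2 * √(P x))) ^ 2 := by
    field_simp
    rw [hsq]
    linarith
  have hpos : 0 < W / (2 * √(P x)) := by positivity
  have h1 : N x / (2 * √(P x)) ≠ -1 := by
    intro h0
    rw [h0] at key
    nlinarith
  have h2 : N x / (2 * √(P x)) ≠ 1 := by
    intro h0
    rw [h0] at key
    nlinarith
  have hd : HasFDerivAt (fun y => N y / (2 * √(P y)))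
      ((1 / (4 * P x * √(P x))) • ((2 * P x) • N' - N x • P')) x := by
    have hsqrt := (hP.sqrt hP0.ne').const_mul (2 : ℝ)
    have := hN.fun_mul ((hasDerivAt_inv (by positivity : 2 * √(P x) ≠ 0)).comp_hasFDerivAt x hsqrt)
    simp only [Function.comp_apply, ← div_eq_mul_inv] at this
    refine this.congr_fderiv ?_
    ext v
    simp only [one_div, FunLike.coe_smul, FunLike.coe_sub, FunLike.coe_add, Pi.smul_apply,
      Pi.sub_apply, Pi.add_apply, smul_eq_mul]
    field_simp
    rw [hsq]
    ring
  have := (Real.hasDerivAt_arccos h1 h2).comp_hasFDerivAt x hd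
  refine this.congr_fderiv ?_
  rw [key, Real.sqrt_sq hpos.le, smul_smul]
  congr 1
  have : √(P x) ≠ 0 := hs.ne'
  field_simp
  norm_num

/-- `A B + B C + C A`. -/
def pairSum (A B C : ℝ) : ℝ := A * B + B * C + C * A

lemma pairSum_pos {A B C : ℝ} (hA : 0 < A) (hB : 0 < B) (hC : 0 < C) : 0 < pairSum A B C := by
  unfold pairSum; positivity

/-- The nondegeneracy quantity as a function of four reciprocal radii. -/
def kissing (A B C D : ℝ) : ℝ := (A + B + C + D) ^ 2 - 2 * (A ^ 2 + B ^ 2 + C ^ 2 + D ^ 2)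

/-- The dihedral angle along the edge joining the first two spheres, as a function of the four
reciprocal radii. -/
noncomputable def dihedralFormula (A B C D : ℝ) : ℝ :=
  Real.arccos (((A + B) * (C + D) - A ^ 2 - B ^ 2) /
    (2 * √(pairSum A B C * pairSum A B D)))

section Angle
variable {V : Type*} {r : V → ℝ}

lemma cos_faceAngle (hr : ∀ v, 0 < r v) (i j k : V) :
    Real.cos (faceAngle r i j k) =
      1 - 2 * (r i)⁻¹ ^ 2 / (((r i)⁻¹ + (r j)⁻¹) * ((r i)⁻¹ + (r k)⁻¹)) := by
  have hi := hr i
  have hj := hr j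
  have hk := hr k
  have e : (edgeLength r i j ^ 2 + edgeLength r i k ^ 2 - edgeLength r j k ^ 2) /
      (2 * edgeLength r i j * edgeLength r i k) =
      1 - 2 * (r j * r k) / ((r i + r j) * (r i + r k)) := by
    unfold edgeLength
    field_simp
    ring
  rw [faceAngle, e, Real.cos_arccos]
  · field_simp
    ring
  · rw [neg_le_sub_iff_le_add, div_le_iff₀ (by positivity)]
    nlinarith [mul_pos hi hj, mul_pos hi hk, mul_pos hi hi]
  · have : 0 ≤ 2 * (r j * r k) / ((r i + r j) * (r i + r k)) := by positivity
    linarith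

lemma sin_faceAngle (hr : ∀ v, 0 < r v) (i j k : V) :
    Real.sin (faceAngle r i j k) =
      2 * (r i)⁻¹ * √(pairSum (r i)⁻¹ (r j)⁻¹ (r k)⁻¹) /
        (((r i)⁻¹ + (r j)⁻¹) * ((r i)⁻¹ + (r k)⁻¹)) := by
  have hi := inv_pos.2 (hr i)
  have hj := inv_pos.2 (hr j)
  have hk := inv_pos.2 (hr k)
  have hc := cos_faceAngle hr i j k
  have h0 : 0 ≤ Real.sin (faceAngle r i j k) :=
    Real.sin_nonneg_of_nonneg_of_le_pi (Real.arccos_nonneg _) (Real.arccos_le_pi _)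
  have hp := pairSum_pos hi hj hk
  rw [← sq_eq_sq₀ h0 (by positivity), Real.sin_sq, hc, div_pow, mul_pow, Real.sq_sqrt hp.le]
  unfold pairSum
  generalize (r i)⁻¹ = A at *
  generalize (r j)⁻¹ = B at *
  generalize (r k)⁻¹ = C at *
  field_simp
  ring

/-- In reciprocal radii all three cosines and the product of sines share the denominator
(A+B)²(A+C)(A+D). It cancels in the spherical law of cosines, leaving a polynomial over the two
square roots from the sines. -/
lemma dihedralAngle_eq (hr : ∀ v, 0 < r v) (i j k l : V) :
    dihedralAngle r i j k l = dihedralFormula (r i)⁻¹ (r j)⁻¹ (r k)⁻¹ (r l)⁻¹ := by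
  have hi := inv_pos.2 (hr i)
  have hj := inv_pos.2 (hr j)
  have hk := inv_pos.2 (hr k)
  have hl := inv_pos.2 (hr l)
  have h1 := pairSum_pos hi hj hk
  have h2 := pairSum_pos hi hj hl
  rw [dihedralAngle, dihedralFormula, cos_faceAngle hr, cos_faceAngle hr, cos_faceAngle hr,
    sin_faceAngle hr, sin_faceAngle hr, Real.sqrt_mul h1.le]
  have h1' := Real.sqrt_pos.2 h1
  have h2' := Real.sqrt_pos.2 h2
  generalize √(pairSum (r i)⁻¹ (r j)⁻¹ (r k)⁻¹) = s at *
  generalize √(pairSum (r i)⁻¹ (r j)⁻¹ (r l)⁻¹) = t at *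
  generalize (r i)⁻¹ = A at *
  generalize (r j)⁻¹ = B at *
  generalize (r k)⁻¹ = C at *
  generalize (r l)⁻¹ = D at *
  congr 1
  field_simp
  ring

end Angle

/-! ### Differentials of dihedral and solid angles -/

/-- `-2 √Q σ(A, B, C) σ(A, B, D)` times the derivative of the dihedral angle in the direction of
its first argument. -/
def dihedralNumerator (A B C D : ℝ) : ℝ :=
  -(2*A*A*B*B + 2*A*A*B*C + 2*A*A*B*D + 2*A*A*C*D - 2*A*B*B*B + A*B*B*C + A*B*B*D + 4*A*B*C*D
    - B*B*B*C - B*B*B*D + B*B*C*C + B*B*D*D)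

/-- The identity behind this is 4P - N² = (A+B)² Q for the arccosine of N / (2√P). Nondegeneracy
keeps the argument away from ±1, and √P disappears, so √Q is the only radical in the derivative. -/
lemma hasFDerivAt_dihedralFormula {E : Type*} [NormedAddCommGroup E] [NormedSpace ℝ E]
    {A B C D : E → ℝ} {A' B' C' D' : E →L[ℝ] ℝ} {x : E}
    (hA : HasFDerivAt A A' x) (hB : HasFDerivAt B B' x)
    (hC : HasFDerivAt C C' x) (hD : HasFDerivAt D D' x)
    (hA0 : 0 < A x) (hB0 : 0 < B x) (hC0 : 0 < C x) (hD0 : 0 < D x)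
    (hQ : 0 < kissing (A x) (B x) (C x) (D x)) :
    HasFDerivAt (fun y => dihedralFormula (A y) (B y) (C y) (D y))
      ((-(1 / (2 * √(kissing (A x) (B x) (C x) (D x)) * pairSum (A x) (B x) (C x) *
          pairSum (A x) (B x) (D x)))) •
        (dihedralNumerator (A x) (B x) (C x) (D x) • A' +
          dihedralNumerator (B x) (A x) (C x) (D x) • B' +
          ((A x + B x) * (A x + B x + C x - D x) * pairSum (A x) (B x) (D x)) • C' +
          ((A x + B x) * (A x + B x + D x - C x) * pairSum (A x) (B x) (C x)) • D')) x := by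
  have hN : HasFDerivAt (fun y => (A y + B y) * (C y + D y) - A y ^ 2 - B y ^ 2) _ x :=
    (((hA.add hB).fun_mul (hC.add hD)).fun_sub (hA.pow 2)).fun_sub (hB.pow 2)
  have hP : HasFDerivAt (fun y => pairSum (A y) (B y) (C y) * pairSum (A y) (B y) (D y)) _ x :=
    (((hA.fun_mul hB).fun_add (hB.fun_mul hC)).fun_add (hC.fun_mul hA)).fun_mul
      (((hA.fun_mul hB).fun_add (hB.fun_mul hD)).fun_add (hD.fun_mul hA))
  have h1 := pairSum_pos hA0 hB0 hC0
  have h2 := pairSum_pos hA0 hB0 hD0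
  have hs := Real.sqrt_pos.2 hQ
  have key := hasFDerivAt_arccos_div_two_sqrt (W := (A x + B x) * √(kissing (A x) (B x) (C x) (D x)))
    hN hP (mul_pos h1 h2) (by positivity) (by
      rw [mul_pow, Real.sq_sqrt hQ.le]; unfold pairSum kissing; ring)
  refine key.congr_fderiv ?_
  ext v
  simp only [FunLike.coe_smul, FunLike.coe_sub, FunLike.coe_add, Pi.smul_apply, Pi.sub_apply,
      Pi.add_apply, smul_eq_mul]
  generalize √(kissing (A x) (B x) (C x) (D x)) = s at *
  have e1 : pairSum (A x) (B x) (C x) = A x * B x + B x * C x + C x * A x := rfl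
  have e2 : pairSum (A x) (B x) (D x) = A x * B x + B x * D x + D x * A x := rfl
  have h1' := h1.ne'
  have h2' := h2.ne'
  have h3' := hs.ne'
  have h4' : A x + B x ≠ 0 := by positivity
  generalize pairSum (A x) (B x) (C x) = p at *
  generalize pairSum (A x) (B x) (D x) = q at *
  unfold dihedralNumerator
  generalize A x = a at *
  generalize B x = b at *
  generalize C x = c at *
  generalize D x = d at *
  field_simp
  subst e1 e2
  ring

/-- The edge weight of a tetrahedron, as a function of the four reciprocal radii. -/
noncomputable def edgeWeight (A B C D : ℝ) : ℝ :=
  A * B * (kissing A B C D + (A + B + D - C) * (A + B + C - D)) /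
    (2 * √(kissing A B C D) * pairSum A B C * pairSum A B D)

lemma edgeWeight_swap (A B C D : ℝ) : edgeWeight B A C D = edgeWeight A B C D := by
  unfold edgeWeight kissing pairSum
  ring_nf

section SolidAngle
variable {V : Type*}

/-- The weight of the edge `{i, j}` in the tetrahedron `{i, j, k, l}`. -/
noncomputable def tetWeight (r : V → ℝ) (i j k l : V) : ℝ :=
  edgeWeight (r i)⁻¹ (r j)⁻¹ (r k)⁻¹ (r l)⁻¹

/-- The differential of the solid angle. -/
noncomputable def solidAngleDeriv (r : V → ℝ) (i j k l : V) : (V → ℝ) →L[ℝ] ℝ :=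
  let e (m : V) : (V → ℝ) →L[ℝ] ℝ := (r m)⁻¹ • ContinuousLinearMap.proj m
  (r i)⁻¹ • (tetWeight r i j k l • (e j - e i) + tetWeight r i k j l • (e k - e i) +
    tetWeight r i l j k • (e l - e i))

lemma solidAngleDeriv_apply (r v : V → ℝ) (i j k l : V) :
    solidAngleDeriv r i j k l v = (r i)⁻¹ *
      (tetWeight r i j k l * ((r j)⁻¹ * v j - (r i)⁻¹ * v i) +
        tetWeight r i k j l * ((r k)⁻¹ * v k - (r i)⁻¹ * v i) +
        tetWeight r i l j k * ((r l)⁻¹ * v l - (r i)⁻¹ * v i)) := by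
  simp [solidAngleDeriv]
  ring

lemma eventually_forall_pos [Fintype V] {r : V → ℝ} (hr : ∀ v, 0 < r v) : ∀ᶠ x in 𝓝 r, ∀ v, 0 < x v :=
  Filter.eventually_all.2 fun v =>
    (continuous_apply v).continuousAt.eventually (lt_mem_nhds (hr v))

/-- Solid angles are scale invariant, so only differences of the logarithmic variations v_m / r_m
can occur. Collecting the three dihedral differentials, the coefficient of each difference is an
edge weight; `edgeWeight_swap` then expresses the symmetry ∂α_i/∂r_j = ∂α_j/∂r_i. -/
lemma hasFDerivAt_solidAngle [Fintype V] {r : V → ℝ} (hr : ∀ v, 0 < r v) (i j k l : V)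
    (hQ : 0 < kissing (r i)⁻¹ (r j)⁻¹ (r k)⁻¹ (r l)⁻¹) :
    HasFDerivAt (fun x => solidAngle x i j k l) (solidAngleDeriv r i j k l) r := by
  have hinv (m : V) : HasFDerivAt (fun x : V → ℝ => (x m)⁻¹)
      ((-((r m) ^ 2)⁻¹) • (ContinuousLinearMap.proj m : (V → ℝ) →L[ℝ] ℝ)) r :=
    (hasDerivAt_inv (hr m).ne').comp_hasFDerivAt r (hasFDerivAt_apply m r)
  have hpos (m : V) : 0 < (r m)⁻¹ := inv_pos.2 (hr m)
  have q1 : kissing (r i)⁻¹ (r k)⁻¹ (r j)⁻¹ (r l)⁻¹ = kissing (r i)⁻¹ (r j)⁻¹ (r k)⁻¹ (r l)⁻¹ := by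
    unfold kissing; ring
  have q2 : kissing (r i)⁻¹ (r l)⁻¹ (r j)⁻¹ (r k)⁻¹ = kissing (r i)⁻¹ (r j)⁻¹ (r k)⁻¹ (r l)⁻¹ := by
    unfold kissing; ring
  have h1 := hasFDerivAt_dihedralFormula (hinv i) (hinv j) (hinv k) (hinv l)
    (hpos i) (hpos j) (hpos k) (hpos l) hQ
  have h2 := hasFDerivAt_dihedralFormula (hinv i) (hinv k) (hinv j) (hinv l)
    (hpos i) (hpos k) (hpos j) (hpos l) (q1 ▸ hQ)
  have h3 := hasFDerivAt_dihedralFormula (hinv i) (hinv l) (hinv j) (hinv k)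
    (hpos i) (hpos l) (hpos j) (hpos k) (q2 ▸ hQ)
  have h := ((h1.fun_add h2).fun_add h3).sub_const Real.pi
  have heq : (fun x => solidAngle x i j k l) =ᶠ[𝓝 r] fun x =>
      dihedralFormula (x i)⁻¹ (x j)⁻¹ (x k)⁻¹ (x l)⁻¹ +
        dihedralFormula (x i)⁻¹ (x k)⁻¹ (x j)⁻¹ (x l)⁻¹ +
        dihedralFormula (x i)⁻¹ (x l)⁻¹ (x j)⁻¹ (x k)⁻¹ - Real.pi := by
    filter_upwards [eventually_forall_pos hr] with x hx
    rw [solidAngle, dihedralAngle_eq hx, dihedralAngle_eq hx, dihedralAngle_eq hx]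
  refine (h.congr_of_eventuallyEq heq).congr_fderiv ?_
  ext v
  rw [solidAngleDeriv_apply]
  simp only [FunLike.coe_smul, FunLike.coe_add, Pi.smul_apply,
      Pi.add_apply, smul_eq_mul, ContinuousLinearMap.proj_apply, tetWeight, edgeWeight, q1, q2,
      ← inv_pow]
  have hs := (Real.sqrt_pos.2 hQ).ne'
  generalize √(kissing (r i)⁻¹ (r j)⁻¹ (r k)⁻¹ (r l)⁻¹) = s at *
  have hi := hpos i
  have hj := hpos j
  have hk := hpos k
  have hl := hpos l
  unfold dihedralNumerator kissing
  have c1 : pairSum (r i)⁻¹ (r k)⁻¹ (r j)⁻¹ = pairSum (r i)⁻¹ (r j)⁻¹ (r k)⁻¹ := by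
    unfold pairSum; ring
  have c2 : pairSum (r i)⁻¹ (r l)⁻¹ (r j)⁻¹ = pairSum (r i)⁻¹ (r j)⁻¹ (r l)⁻¹ := by
    unfold pairSum; ring
  have c3 : pairSum (r i)⁻¹ (r l)⁻¹ (r k)⁻¹ = pairSum (r i)⁻¹ (r k)⁻¹ (r l)⁻¹ := by
    unfold pairSum; ring
  rw [c1, c2, c3]
  have n1 := (pairSum_pos hi hj hk).ne'
  have n2 := (pairSum_pos hi hj hl).ne'
  have n3 := (pairSum_pos hi hk hl).ne'
  have e1 : pairSum (r i)⁻¹ (r j)⁻¹ (r k)⁻¹ = (r i)⁻¹ * (r j)⁻¹ + (r j)⁻¹ * (r k)⁻¹ + (r k)⁻¹ * (r i)⁻¹ := rfl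
  have e2 : pairSum (r i)⁻¹ (r j)⁻¹ (r l)⁻¹ = (r i)⁻¹ * (r j)⁻¹ + (r j)⁻¹ * (r l)⁻¹ + (r l)⁻¹ * (r i)⁻¹ := rfl
  have e3 : pairSum (r i)⁻¹ (r k)⁻¹ (r l)⁻¹ = (r i)⁻¹ * (r k)⁻¹ + (r k)⁻¹ * (r l)⁻¹ + (r l)⁻¹ * (r i)⁻¹ := rfl
  generalize pairSum (r i)⁻¹ (r j)⁻¹ (r k)⁻¹ = x at *
  generalize pairSum (r i)⁻¹ (r j)⁻¹ (r l)⁻¹ = y at *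
  generalize pairSum (r i)⁻¹ (r k)⁻¹ (r l)⁻¹ = z at *
  generalize (r i)⁻¹ = A at *
  generalize (r j)⁻¹ = B at *
  generalize (r k)⁻¹ = C at *
  generalize (r l)⁻¹ = D at *
  field_simp
  subst e1 e2 e3
  ring

end SolidAngle

/-! ### Positivity of the energy of one tetrahedron -/

/-- The Dirichlet energy of a tetrahedron. -/
noncomputable def tetEnergy (A B C D x y z w : ℝ) : ℝ :=
  edgeWeight A B C D * (x - y) ^ 2 + edgeWeight A C B D * (x - z) ^ 2 +
    edgeWeight A D B C * (x - w) ^ 2 + edgeWeight B C A D * (y - z) ^ 2 +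
    edgeWeight B D A C * (y - w) ^ 2 + edgeWeight C D A B * (z - w) ^ 2

/-- A Laplacian form with weights `p i * p j * u k * u l` is nonnegative as long as only the last
`u` may be nonpositive and `∑ p i * u j * u k * u l` is nonnegative. -/
lemma complementary_form_nonneg {p q s t a b c d : ℝ} (hp : 0 < p) (hq : 0 < q) (hs : 0 < s)
    (ht : 0 < t) (ha : 0 < a) (hb : 0 < b) (hc : 0 < c)
    (h : 0 ≤ p * b * c * d + q * a * c * d + s * a * b * d + t * a * b * c) (x y z w : ℝ) :
    0 ≤ p * q * (c * d) * (x - y) ^ 2 + p * s * (b * d) * (x - z) ^ 2 +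
      p * t * (b * c) * (x - w) ^ 2 + q * s * (a * d) * (y - z) ^ 2 +
      q * t * (a * c) * (y - w) ^ 2 + s * t * (a * b) * (z - w) ^ 2 := by
  rcases le_or_gt 0 d with hd | hd
  · positivity
  -- This is the variance identity ∑ M_i M_j (x_i - x_j)² = (∑ M_i)(∑ M_i (x_i - w)²) - (∑ M_i (x_i
  -- - w))² for the masses p/a, q/b, s/c, t/d, with denominators cleared. The sign of d turns the
  -- subtracted square into a nonnegative term.
  · have key : (a * b * c) * (p * q * (c * d) * (x - y) ^ 2 + p * s * (b * d) * (x - z) ^ 2 +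
      p * t * (b * c) * (x - w) ^ 2 + q * s * (a * d) * (y - z) ^ 2 +
      q * t * (a * c) * (y - w) ^ 2 + s * t * (a * b) * (z - w) ^ 2) =
      (p * b * c * d + q * a * c * d + s * a * b * d + t * a * b * c) *
        (p * b * c * (x - w) ^ 2 + q * a * c * (y - w) ^ 2 + s * a * b * (z - w) ^ 2) +
      (-d) * (p * b * c * (x - w) + q * a * c * (y - w) + s * a * b * (z - w)) ^ 2 := by ring
    have : 0 ≤ -d := by linarith
    refine nonneg_of_mul_nonneg_right (a := a * b * c) ?_ (by positivity)
    rw [key]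
    positivity

/-- Over the common denominator the edge AB has weight p q (Q + u_C u_D), where p = A σ(B,C,D), q =
B σ(A,C,D), u_C = A+B+D-C and u_D = A+B+C-D; the other edges are analogous. The Q part is a
complete-graph form with positive product weights, and the u part is the remainder treated by
`complementary_form_nonneg`. -/
lemma tetEnergy_eq {A B C D : ℝ} (hA : 0 < A) (hB : 0 < B) (hC : 0 < C) (hD : 0 < D)
    (hQ : 0 < kissing A B C D) (x y z w : ℝ) :
    ∃ m > 0, ∃ G ≥ 0, ∃ p > 0, ∃ q > 0, ∃ s > 0, ∃ t > 0, tetEnergy A B C D x y z w =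
      m * (p * q * (x - y) ^ 2 + p * s * (x - z) ^ 2 + p * t * (x - w) ^ 2 + q * s * (y - z) ^ 2 +
        q * t * (y - w) ^ 2 + s * t * (z - w) ^ 2) + G := by
  have n1 := pairSum_pos hA hB hC
  have n2 := pairSum_pos hA hB hD
  have n3 := pairSum_pos hA hC hD
  have n4 := pairSum_pos hB hC hD
  have hs := Real.sqrt_pos.2 hQ
  set G := A * pairSum B C D * (B * pairSum A C D) * ((A + B + D - C) * (A + B + C - D)) *
      (x - y) ^ 2 +
    A * pairSum B C D * (C * pairSum A B D) * ((A + C + D - B) * (A + B + C - D)) * (x - z) ^ 2 +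
    A * pairSum B C D * (D * pairSum A B C) * ((A + C + D - B) * (A + B + D - C)) * (x - w) ^ 2 +
    B * pairSum A C D * (C * pairSum A B D) * ((B + C + D - A) * (A + B + C - D)) * (y - z) ^ 2 +
    B * pairSum A C D * (D * pairSum A B C) * ((B + C + D - A) * (A + B + D - C)) * (y - w) ^ 2 +
    C * pairSum A B D * (D * pairSum A B C) * ((B + C + D - A) * (A + C + D - B)) * (z - w) ^ 2
    with hGdef
  have hpA : 0 < A * pairSum B C D := by positivity
  have hpB : 0 < B * pairSum A C D := by positivity
  have hpC : 0 < C * pairSum A B D := by positivity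
  have hpD : 0 < D * pairSum A B C := by positivity
  -- The sum required by `complementary_form_nonneg` factors as Q times a polynomial with positive
  -- coefficients.
  have hsum : 0 ≤ A * pairSum B C D * (A + C + D - B) * (A + B + D - C) * (A + B + C - D) +
      B * pairSum A C D * (B + C + D - A) * (A + B + D - C) * (A + B + C - D) +
      C * pairSum A B D * (B + C + D - A) * (A + C + D - B) * (A + B + C - D) +
      D * pairSum A B C * (B + C + D - A) * (A + C + D - B) * (A + B + D - C) := by
    have : A * pairSum B C D * (A + C + D - B) * (A + B + D - C) * (A + B + C - D) +
      B * pairSum A C D * (B + C + D - A) * (A + B + D - C) * (A + B + C - D) +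
      C * pairSum A B D * (B + C + D - A) * (A + C + D - B) * (A + B + C - D) +
      D * pairSum A B C * (B + C + D - A) * (A + C + D - B) * (A + B + D - C) =
      kissing A B C D * (A*A*B*C + A*A*B*D + A*A*C*D + A*B*B*C + A*B*B*D + A*B*C*C + A*B*D*D +
        A*C*C*D + A*C*D*D + B*B*C*D + B*C*C*D + B*C*D*D) := by
      unfold kissing pairSum; ring
    rw [this]; positivity
  -- Two of the u's always have a positive sum, for instance u_C + u_D = 2(A+B), so at most one is
  -- nonpositive. The cases move that one into the last slot.
  have hG : 0 ≤ G := by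
    rcases lt_or_ge 0 (B + C + D - A) with hA' | hA'
    · rcases lt_or_ge 0 (A + C + D - B) with hB' | hB'
      · rcases lt_or_ge 0 (A + B + D - C) with hC' | hC'
        · refine (complementary_form_nonneg hpA hpB hpC hpD hA' hB' hC' (d := A + B + C - D)
            (by linarith) x y z w).trans_eq ?_
          rw [hGdef]
        · refine (complementary_form_nonneg hpA hpB hpD hpC hA' hB'
            (by linarith : 0 < A + B + C - D) (d := A + B + D - C)
            (by linarith) x y w z).trans_eq ?_
          rw [hGdef]; ring
      · refine (complementary_form_nonneg hpA hpC hpD hpB hA'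
            (by linarith : 0 < A + B + D - C) (by linarith : 0 < A + B + C - D) (d := A + C + D - B)
            (by linarith) x z w y).trans_eq ?_
        rw [hGdef]; ring
    · refine (complementary_form_nonneg hpB hpC hpD hpA (by linarith : 0 < A + C + D - B)
            (by linarith : 0 < A + B + D - C) (by linarith : 0 < A + B + C - D) (d := B + C + D - A)
            (by linarith) y z w x).trans_eq ?_
      rw [hGdef]; ring
  have k1 : kissing A C B D = kissing A B C D := by unfold kissing; ring
  have k2 : kissing A D B C = kissing A B C D := by unfold kissing; ring
  have k3 : kissing B C A D = kissing A B C D := by unfold kissing; ring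
  have k4 : kissing B D A C = kissing A B C D := by unfold kissing; ring
  have k5 : kissing C D A B = kissing A B C D := by unfold kissing; ring
  have hM : 0 < 2 * √(kissing A B C D) * pairSum A B C * pairSum A B D * pairSum A C D *
      pairSum B C D := by positivity
  refine ⟨kissing A B C D / (2 * √(kissing A B C D) * pairSum A B C * pairSum A B D *
      pairSum A C D * pairSum B C D), div_pos hQ hM,
    G / (2 * √(kissing A B C D) * pairSum A B C * pairSum A B D * pairSum A C D * pairSum B C D),
    div_nonneg hG hM.le, _, hpA, _, hpB, _, hpC, _, hpD, ?_⟩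
  have hperm (a b c : ℝ) : pairSum a b c = pairSum b a c ∧ pairSum a b c = pairSum a c b := by
    unfold pairSum; constructor <;> ring
  have p1 : pairSum A C B = pairSum A B C := ((hperm _ _ _).2).symm
  have p2 : pairSum A D B = pairSum A B D := ((hperm _ _ _).2).symm
  have p3 : pairSum A D C = pairSum A C D := ((hperm _ _ _).2).symm
  have p4 : pairSum B C A = pairSum A B C := by unfold pairSum; ring
  have p5 : pairSum B D A = pairSum A B D := by unfold pairSum; ring
  have p6 : pairSum B D C = pairSum B C D := ((hperm _ _ _).2).symm
  have p7 : pairSum C D A = pairSum A C D := by unfold pairSum; ring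
  have p8 : pairSum C D B = pairSum B C D := by unfold pairSum; ring
  rw [hGdef]
  unfold tetEnergy edgeWeight
  rw [k1, k2, k3, k4, k5, p1, p2, p3, p4, p5, p6, p7, p8]
  clear_value G
  generalize √(kissing A B C D) = σ at *
  generalize kissing A B C D = κ at *
  generalize pairSum A B C = e at *
  generalize pairSum A B D = f at *
  generalize pairSum A C D = g at *
  generalize pairSum B C D = h at *
  field_simp
  ring

lemma tetEnergy_nonneg {A B C D : ℝ} (hA : 0 < A) (hB : 0 < B) (hC : 0 < C) (hD : 0 < D)
    (hQ : 0 < kissing A B C D) (x y z w : ℝ) : 0 ≤ tetEnergy A B C D x y z w := by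
  obtain ⟨m, hm, G, hG, p, hp, q, hq, s, hs, t, ht, h⟩ := tetEnergy_eq hA hB hC hD hQ x y z w
  rw [h]
  positivity

lemma eq_of_tetEnergy_eq_zero {A B C D : ℝ} (hA : 0 < A) (hB : 0 < B) (hC : 0 < C) (hD : 0 < D)
    (hQ : 0 < kissing A B C D) {x y z w : ℝ} (h0 : tetEnergy A B C D x y z w = 0) : x = y := by
  obtain ⟨m, hm, G, hG, p, hp, q, hq, s, hs, t, ht, h⟩ := tetEnergy_eq hA hB hC hD hQ x y z w
  rw [h] at h0
  have h1 : 0 ≤ m * (p * s * (x - z) ^ 2 + p * t * (x - w) ^ 2 + q * s * (y - z) ^ 2 +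
        q * t * (y - w) ^ 2 + s * t * (z - w) ^ 2) := by positivity
  have h2 : m * (p * q) * (x - y) ^ 2 ≤ 0 := by linarith
  have h3 : 0 < m * (p * q) := by positivity
  have h4 : (x - y) ^ 2 ≤ 0 := nonpos_of_mul_nonpos_right h2 h3
  have h5 : x - y = 0 := by nlinarith
  linarith

/-! ### Weighted graph Laplacians and the Rayleigh bound -/

section Laplacian
variable {V : Type*} [Fintype V]

/-- The Dirichlet energy of a function on a weighted graph. -/
noncomputable def energy (W : V → V → ℝ) (f : V → ℝ) : ℝ :=
  (∑ i, ∑ j, W i j * (f i - f j) ^ 2) / 2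

variable {W : V → V → ℝ}

/-- Summation by parts; it needs symmetry of the weights but no sign condition. -/
lemma green_identity (hW : ∀ i j, W i j = W j i) (f g : V → ℝ) :
    ∑ i, g i * ∑ j, W i j * (f i - f j) =
      (∑ i, ∑ j, W i j * ((g i - g j) * (f i - f j))) / 2 := by
  have h1 : ∑ i, g i * ∑ j, W i j * (f i - f j) = ∑ i, ∑ j, W i j * (g i * (f i - f j)) :=
    Finset.sum_congr rfl fun i _ => by
      rw [Finset.mul_sum]; exact Finset.sum_congr rfl fun j _ => by ring
  have h2 : ∑ i, ∑ j, W i j * (g i * (f i - f j)) = ∑ i, ∑ j, W i j * (g j * (f j - f i)) := by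
    rw [Finset.sum_comm]
    exact Finset.sum_congr rfl fun i _ => Finset.sum_congr rfl fun j _ => by rw [hW]
  have h3 : ∑ i, ∑ j, W i j * ((g i - g j) * (f i - f j)) =
      ∑ i, ∑ j, W i j * (g i * (f i - f j)) + ∑ i, ∑ j, W i j * (g j * (f j - f i)) := by
    simp only [← Finset.sum_add_distrib]
    exact Finset.sum_congr rfl fun i _ => Finset.sum_congr rfl fun j _ => by ring
  rw [h1, h3, ← h2]
  ring

lemma sum_mul_laplacian_self (hW : ∀ i j, W i j = W j i) (f : V → ℝ) :
    ∑ i, f i * ∑ j, W i j * (f i - f j) = energy W f := by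
  rw [green_identity hW, energy]
  simp only [pow_two]

lemma sum_laplacian (hW : ∀ i j, W i j = W j i) (f : V → ℝ) :
    ∑ i, ∑ j, W i j * (f i - f j) = 0 := by
  simpa using green_identity hW f 1

/-- Rayleigh quotient bound: the Dirichlet energy of a function of mean zero is bounded below by
the first positive eigenvalue of the Laplacian. -/
lemma sInf_eigenvalue_mul_le_energy (hW : ∀ i j, W i j = W j i) {m : V → ℝ} (hm : ∀ i, 0 < m i)
    {L : (V → ℝ) →ₗ[ℝ] (V → ℝ)} (hL : ∀ f i, m i * L f i = ∑ j, W i j * (f i - f j))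
    (hnonneg : ∀ f, 0 ≤ energy W f) (hzero : ∀ f, energy W f = 0 → ∀ i j, f i = f j)
    {f : V → ℝ} (hf : ∑ i, m i * f i = 0) :
    sInf {μ : ℝ | 0 < μ ∧ Module.End.HasEigenvalue L μ} * ∑ i, m i * f i ^ 2 ≤ energy W f := by
  obtain ⟨w, hs, hsq⟩ : ∃ w : V → ℝ, (∀ i, 0 < w i) ∧ ∀ i, w i * w i = m i :=
    ⟨fun i => √(m i), fun i => Real.sqrt_pos.2 (hm i), fun i => Real.mul_self_sqrt (hm i).le⟩
  -- Conjugating L by √m turns self-adjointness for the masses m into symmetry for the Euclidean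
  -- inner product, so an orthonormal eigenbasis exists.
  let T : EuclideanSpace ℝ V →ₗ[ℝ] EuclideanSpace ℝ V :=
    { toFun g := WithLp.toLp 2 fun i => w i * L (fun j => g j / w j) i
      map_add' g h := by
        ext i
        have : (fun j => (g + h) j / w j) =
            (fun j => g j / w j) + fun j => h j / w j := by
          funext j; simp [add_div]
        rw [this, map_add]
        exact mul_add _ _ _
      map_smul' c g := by
        ext i
        have : (fun j => (c • g) j / w j) = c • fun j => g j / w j := by
          funext j; simp [mul_div_assoc]
        rw [this, map_smul]
        exact mul_left_comm _ _ _ }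
  have hTapply (g : EuclideanSpace ℝ V) (i : V) :
      T g i = w i * L (fun j => g j / w j) i := rfl
  have hinner (g h : EuclideanSpace ℝ V) : inner ℝ g (T h) =
      ∑ i, (g i / w i) * ∑ j, W i j * (h i / w i - h j / w j) := by
    simp only [PiLp.inner_apply, hTapply]
    refine Finset.sum_congr rfl fun i _ => ?_
    rw [← hL (fun j => h j / w j) i]
    have := (hs i).ne'
    simp only [RCLike.inner_apply, conj_trivial]
    rw [← hsq i]
    field_simp
  have hT : T.IsSymmetric := by
    intro g h
    rw [real_inner_comm, hinner, hinner, green_identity hW (fun i => h i / w i) fun i => g i / w i,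
      green_identity hW (fun i => g i / w i) fun i => h i / w i]
    simp only [mul_comm]
  have hn : Module.finrank ℝ (EuclideanSpace ℝ V) = Fintype.card V := finrank_euclideanSpace
  let b := hT.eigenvectorBasis hn
  let μ := hT.eigenvalues hn
  have hb (k) : T (b k) = μ k • b k := hT.apply_eigenvectorBasis hn k
  have hself (g : EuclideanSpace ℝ V) : inner ℝ g (T g) = energy W fun i => g i / w i := by
    rw [hinner, sum_mul_laplacian_self hW fun i => g i / w i]
  have hμ (k) : μ k = energy W fun i => b k i / w i := by
    rw [← hself, hb, inner_smul_right, real_inner_self_eq_norm_sq, b.norm_eq_one]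
    simp
  have heig (k) : Module.End.HasEigenvalue L (μ k) := by
    refine Module.End.hasEigenvalue_of_hasEigenvector
      (x := fun i => b k i / w i) ⟨?_, fun h0 => ?_⟩
    · rw [Module.End.mem_eigenspace_iff]
      funext i
      have h1 : T (b k) i = μ k * b k i := by rw [hb]; rfl
      rw [hTapply] at h1
      have := (hs i).ne'
      simp only [Pi.smul_apply, smul_eq_mul]
      field_simp
      linarith
    · refine b.toBasis.ne_zero k ?_
      ext i
      have h1 := congrFun h0 i
      have := (hs i).ne'
      simpa [this] using h1
  let g : EuclideanSpace ℝ V := WithLp.toLp 2 fun i => w i * f i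
  have hg : (fun i => g i / w i) = f := by
    funext i
    have := (hs i).ne'
    simp only [g]
    field_simp
  have hE : energy W f = ∑ k, μ k * inner ℝ (b k) g ^ 2 := by
    rw [← hg, ← hself, ← b.sum_inner_mul_inner]
    refine Finset.sum_congr rfl fun k _ => ?_
    rw [← hT, hb, inner_smul_left, real_inner_comm g]
    simp only [conj_trivial]
    ring
  have hN : ∑ i, m i * f i ^ 2 = ∑ k, inner ℝ (b k) g ^ 2 := by
    have h1 := b.sum_inner_mul_inner g g
    have h2 : inner ℝ g g = ∑ i, m i * f i ^ 2 := by
      simp only [PiLp.inner_apply, g, RCLike.inner_apply, conj_trivial]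
      refine Finset.sum_congr rfl fun i _ => ?_
      rw [← hsq i]; ring
    rw [← h2, ← h1]
    exact Finset.sum_congr rfl fun k _ => by rw [real_inner_comm g, pow_two]
  rw [hE, hN, Finset.mul_sum]
  refine Finset.sum_le_sum fun k _ => ?_
  rcases (hμ k ▸ hnonneg _ : 0 ≤ μ k).eq_or_lt with h0 | h0
  · have hconst := hzero _ ((hμ k).symm.trans h0.symm)
    have : inner ℝ (b k) g = 0 := by
      rcases isEmpty_or_nonempty V with hV | ⟨⟨i₀⟩⟩
      · simp [PiLp.inner_apply]
      · have h1 : inner ℝ (b k) g = (b k i₀ / w i₀) * ∑ i, m i * f i := by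
          rw [Finset.mul_sum, PiLp.inner_apply]
          refine Finset.sum_congr rfl fun i _ => ?_
          rw [← hconst i i₀, ← hsq i]
          have := (hs i).ne'
          simp only [g, RCLike.inner_apply, conj_trivial]
          field_simp
        rw [h1, hf, mul_zero]
    simp [this]
  · exact mul_le_mul_of_nonneg_right (csInf_le ⟨0, fun x hx => hx.1.le⟩ ⟨h0, heig k⟩) (sq_nonneg _)

end Laplacian

/-! ### From connectedness of the realization to constancy on vertices -/

section Connected
variable {V : Type*} [Fintype V]

/-- A function on the vertices of a connected complex which is constant on each face is constant. -/
lemma eq_of_connected_realization (K : AbstractSimplicialComplex V)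
    [ConnectedSpace (realization K)] {f : V → ℝ}
    (hf : ∀ s ∈ K.faces, ∀ i ∈ s, ∀ j ∈ s, f i = f j) (i j : V) : f i = f j := by
  classical
  -- The piecewise linear extension of f takes only values of f, hence finitely many, and a
  -- continuous function with finite range on a connected space is constant.
  let g : realization K → ℝ := fun x => ∑ v, (x : V → ℝ) v * f v
  have hg : Continuous g := continuous_finsetSum _ fun v _ =>
    ((continuous_apply v).comp continuous_subtype_val).mul continuous_const
  have hrange (x : realization K) : g x ∈ Set.range f := by
    obtain ⟨x, ⟨hx0, hx1⟩, s, hs, hxs⟩ := x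
    obtain ⟨v₀, hv₀⟩ := (K.isRelLowerSet_faces hs).1
    refine ⟨v₀, ?_⟩
    have : ∀ v, x v * f v = x v * f v₀ := fun v => by
      by_cases hv : v ∈ s
      · rw [hf s hs v hv v₀ hv₀]
      · rw [hxs v hv, zero_mul, zero_mul]
    simp only [g, this, ← Finset.sum_mul, hx1, one_mul]
  have hsub : (Set.range g).Subsingleton :=
    Set.not_nontrivial_iff.1 fun h => (isPreconnected_range hg).infinite_of_nontrivial h
      ((Set.finite_range f).subset (Set.range_subset_iff.2 hrange))
  let e (v : V) : realization K := ⟨Pi.single v 1, single_mem_stdSimplex ℝ v, {v},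
    K.singleton_mem v, fun w hw => Pi.single_eq_of_ne (by simpa using hw) _⟩
  have he (v : V) : g (e v) = f v := by
    simp [g, e, Pi.single_apply]
  rw [← he i, ← he j]
  exact hsub ⟨_, rfl⟩ ⟨_, rfl⟩

end Connected

lemma pairwise_ne_of_card_eq_four {V : Type*} [DecidableEq V] {i j k l : V}
    (h : ({i, j, k, l} : Finset V).card = 4) :
    i ≠ j ∧ i ≠ k ∧ i ≠ l ∧ j ≠ k ∧ j ≠ l ∧ k ≠ l := by
  refine ⟨?_, ?_, ?_, ?_, ?_, ?_⟩ <;> rintro rfl <;> revert h <;> simp only [Finset.mem_insert,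
    Finset.mem_singleton, true_or, or_true, Finset.insert_eq_of_mem, imp_false] <;>
    exact (Finset.card_le_three.trans_lt (by norm_num)).ne

/-! ### The curvature differential as a graph Laplacian -/

section Curvature
variable {V : Type*} [Fintype V] [DecidableEq V] {M : Type*} [TopologicalSpace M]
  {T : Triangulation V M} {r : V → ℝ}

lemma kissing_pos (hr : r ∈ admissible T) {i j k l : V} (h : T.IsTetrahedron {i, j, k, l}) :
    0 < kissing (r i)⁻¹ (r j)⁻¹ (r k)⁻¹ (r l)⁻¹ := by
  obtain ⟨h1, h2, h3, h4, h5, h6⟩ := pairwise_ne_of_card_eq_four h.2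
  refine (hr.2 _ h).trans_eq ?_
  rw [nondegeneracy, kissing]
  repeat rw [Finset.sum_insert (by simp [*])]
  simp only [Finset.sum_singleton, one_div, inv_pow]
  ring

open Classical in
/-- The weight of the edge `{i, j}` in `{i, j, k, l}`, zero if this is not a tetrahedron. -/
noncomputable def localWeight (T : Triangulation V M) (r : V → ℝ) (i j k l : V) : ℝ :=
  if T.IsTetrahedron {i, j, k, l} then tetWeight r i j k l else 0

/-- The weight of the edge `{i, j}`, summed over the tetrahedra containing it. -/
noncomputable def vertexWeight (T : Triangulation V M) (r : V → ℝ) (i j : V) : ℝ :=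
  (∑ k, ∑ l, localWeight T r i j k l) / 2

lemma localWeight_swap (i j k l : V) : localWeight T r j i k l = localWeight T r i j k l := by
  rw [localWeight, localWeight, Finset.insert_comm, tetWeight, tetWeight, edgeWeight_swap]

lemma vertexWeight_symm (i j : V) : vertexWeight T r i j = vertexWeight T r j i := by
  simp only [vertexWeight, localWeight_swap i j]

lemma vertexWeight_eq_zero {i j : V} (hij : i ≠ j) (h : ¬ T.Adjacent i j) :
    vertexWeight T r i j = 0 := by
  rw [vertexWeight, Finset.sum_eq_zero, zero_div]
  intro k _
  refine Finset.sum_eq_zero fun l _ => if_neg fun ht => h ⟨hij, ?_⟩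
  refine (T.isRelLowerSet_faces ht.1).2 ?_ (by simp)
  intro x hx
  simp only [Finset.mem_insert, Finset.mem_singleton] at hx ⊢
  tauto

open Classical in
/-- The differential of the curvature at a vertex. -/
noncomputable def curvatureFDeriv (T : Triangulation V M) (r : V → ℝ) (i : V) :
    (V → ℝ) →L[ℝ] ℝ :=
  -((6 : ℝ)⁻¹ • ∑ j, ∑ k, ∑ l,
    if T.IsTetrahedron {i, j, k, l} then solidAngleDeriv r i j k l else 0)

lemma hasFDerivAt_curvature (hr : r ∈ admissible T) (i : V) :
    HasFDerivAt (fun x => curvature T x i) (curvatureFDeriv T r i) r := by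
  classical
  unfold curvature curvatureFDeriv
  simp only [div_eq_inv_mul]
  refine (HasFDerivAt.const_mul ?_ _).const_sub _
  refine HasFDerivAt.fun_sum fun j _ => HasFDerivAt.fun_sum fun k _ =>
    HasFDerivAt.fun_sum fun l _ => ?_
  split_ifs with h
  · exact hasFDerivAt_solidAngle hr.1 i j k l (kissing_pos hr h)
  · exact hasFDerivAt_const _ _

/-- Renaming summation indices makes the contributions of the three edges at i equal, so the factor
1/6 for ordered triples becomes the 1/2 in `vertexWeight`. -/
lemma curvatureFDeriv_apply (v : V → ℝ) (i : V) :
    curvatureFDeriv T r i v =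
      (r i)⁻¹ * ∑ j, vertexWeight T r i j * ((r i)⁻¹ * v i - (r j)⁻¹ * v j) := by
  classical
  set f : V → ℝ := fun m => (r m)⁻¹ * v m with hf
  have h0 (j k l : V) :
      (if T.IsTetrahedron {i, j, k, l} then solidAngleDeriv r i j k l else 0) v =
      (r i)⁻¹ * (localWeight T r i j k l * (f j - f i) + localWeight T r i k j l * (f k - f i) +
        localWeight T r i l j k * (f l - f i)) := by
    have e1 : ({i, k, j, l} : Finset V) = {i, j, k, l} := by
      rw [Finset.insert_comm k j]
    have e2 : ({i, l, j, k} : Finset V) = {i, j, k, l} := by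
      rw [Finset.insert_comm l j, Finset.pair_comm]
    simp only [localWeight, e1, e2]
    split_ifs
    · rw [solidAngleDeriv_apply]
    · simp
  have h1 : ∑ j, ∑ k, ∑ l, localWeight T r i k j l * (f k - f i) =
      ∑ j, ∑ k, ∑ l, localWeight T r i j k l * (f j - f i) := Finset.sum_comm
  have h2 : ∑ j, ∑ k, ∑ l, localWeight T r i l j k * (f l - f i) =
      ∑ j, ∑ k, ∑ l, localWeight T r i j k l * (f j - f i) := by
    rw [← h1]
    exact Finset.sum_congr rfl fun j _ => Finset.sum_comm
  have h3 : ∑ j, vertexWeight T r i j * (f i - f j) =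
      -((∑ j, ∑ k, ∑ l, localWeight T r i j k l * (f j - f i)) / 2) := by
    rw [Finset.sum_div, ← Finset.sum_neg_distrib]
    refine Finset.sum_congr rfl fun j _ => ?_
    simp only [vertexWeight, ← Finset.sum_mul]
    ring
  rw [h3]
  simp only [curvatureFDeriv, FunLike.coe_neg, Pi.neg_apply, FunLike.coe_smul, Pi.smul_apply,
    FunLike.coe_sum, Finset.sum_apply, h0, smul_eq_mul, ← Finset.mul_sum, Finset.sum_add_distrib,
    h1, h2]
  ring

lemma curvatureDeriv_eq (hr : r ∈ admissible T) {i j : V} (hij : i ≠ j) :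
    curvatureDeriv T r i j = -((r i)⁻¹ * (vertexWeight T r i j * (r j)⁻¹)) := by
  have h : HasDerivAt (fun x => curvature T (Function.update r j x) i)
      (curvatureFDeriv T r i (Pi.single j 1)) (r j) := by
    have h1 := hasDerivAt_update r j (r j)
    refine HasFDerivAt.comp_hasDerivAt (r j) (l := fun x => curvature T x i) ?_ h1
    rw [Function.update_eq_self]
    exact hasFDerivAt_curvature hr i
  rw [curvatureDeriv, h.deriv, curvatureFDeriv_apply, Finset.sum_eq_single j]
  · simp [hij]
  · intro k _ hk
    simp [hij, hk]
  · simp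

/-- The mass exponent is α + 1 because the definition of Δ_α divides by r_i^α and the derivative of
K_i brings one more 1/r_i. Non-adjacent pairs have weight zero, so the sum may run over all j. -/
lemma rpow_mul_alphaLaplacian (hr : r ∈ admissible T) (α : ℝ) (f : V → ℝ) (i : V) :
    r i ^ (α + 1) * (-(alphaLaplacian T α r)) f i =
      ∑ j, vertexWeight T r i j * (f i - f j) := by
  classical
  have hi := hr.1 i
  have hα : r i ^ α ≠ 0 := (Real.rpow_pos_of_pos hi α).ne'
  have h1 : ∑ j ∈ Finset.univ.filter (fun j => T.Adjacent i j),
      (-(curvatureDeriv T r i j) * r j) * (f j - f i) =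
      -((r i)⁻¹ * ∑ j, vertexWeight T r i j * (f i - f j)) := by
    rw [Finset.mul_sum, ← Finset.sum_neg_distrib, Finset.sum_filter]
    refine Finset.sum_congr rfl fun j _ => ?_
    split_ifs with h
    · rw [curvatureDeriv_eq hr h.1]
      have := (hr.1 j).ne'
      field_simp
      ring
    · rcases eq_or_ne i j with rfl | hij
      · simp
      · simp [vertexWeight_eq_zero hij h]
  have h2 : (-(alphaLaplacian T α r)) f i = -(1 / r i ^ α *
      ∑ j ∈ Finset.univ.filter (fun j => T.Adjacent i j),
      (-(curvatureDeriv T r i j) * r j) * (f j - f i)) := by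
    rw [LinearMap.neg_apply, Pi.neg_apply]
    congr
  rw [h2, h1, Real.rpow_add hi, Real.rpow_one]
  field_simp

/-- Each of the six summands is F with its indices permuted, so all have the same total. -/
lemma sum_swap_eq {ι : Type*} [Fintype ι] (F : ι → ι → ι → ι → ℝ) :
    ∑ i, ∑ j, ∑ k, ∑ l, (F i j k l + F i k j l + F i l j k + F j k i l + F j l i k + F k l i j) =
      6 * ∑ i, ∑ j, ∑ k, ∑ l, F i j k l := by
  have h12 (G : ι → ι → ι → ι → ℝ) : ∑ i, ∑ j, ∑ k, ∑ l, G j i k l = ∑ i, ∑ j, ∑ k, ∑ l, G i j k l :=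
    Finset.sum_comm
  have h23 (G : ι → ι → ι → ι → ℝ) : ∑ i, ∑ j, ∑ k, ∑ l, G i k j l = ∑ i, ∑ j, ∑ k, ∑ l, G i j k l :=
    Finset.sum_congr rfl fun _ _ => Finset.sum_comm
  have h34 (G : ι → ι → ι → ι → ℝ) : ∑ i, ∑ j, ∑ k, ∑ l, G i j l k = ∑ i, ∑ j, ∑ k, ∑ l, G i j k l :=
    Finset.sum_congr rfl fun _ _ => Finset.sum_congr rfl fun _ _ => Finset.sum_comm
  have e1 := h23 F
  have e2 := (h34 fun i j k l => F i k j l).trans e1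
  have e3 := (h12 fun i j k l => F i k j l).trans e1
  have e4 := (h34 fun i j k l => F j k i l).trans e3
  have e5 := (h23 fun i j k l => F j l i k).trans e4
  simp only [Finset.sum_add_distrib, e1, e2, e3, e4, e5]
  ring

-- Assembles the global energy from tetrahedra, each of which occurs for 24 ordered quadruples.
open Classical in
lemma energy_vertexWeight (f : V → ℝ) :
    energy (vertexWeight T r) f = (∑ i, ∑ j, ∑ k, ∑ l, if T.IsTetrahedron {i, j, k, l} then
      tetEnergy (r i)⁻¹ (r j)⁻¹ (r k)⁻¹ (r l)⁻¹ (f i) (f j) (f k) (f l) else 0) / 24 := by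
  have h0 (i j k l : V) : (if T.IsTetrahedron {i, j, k, l} then
      tetEnergy (r i)⁻¹ (r j)⁻¹ (r k)⁻¹ (r l)⁻¹ (f i) (f j) (f k) (f l) else 0) =
      localWeight T r i j k l * (f i - f j) ^ 2 + localWeight T r i k j l * (f i - f k) ^ 2 +
      localWeight T r i l j k * (f i - f l) ^ 2 + localWeight T r j k i l * (f j - f k) ^ 2 +
      localWeight T r j l i k * (f j - f l) ^ 2 + localWeight T r k l i j * (f k - f l) ^ 2 := by
    have e1 : ({i, k, j, l} : Finset V) = {i, j, k, l} := by
      ext; simp only [Finset.mem_insert, Finset.mem_singleton]; tauto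
    have e2 : ({i, l, j, k} : Finset V) = {i, j, k, l} := by
      ext; simp only [Finset.mem_insert, Finset.mem_singleton]; tauto
    have e3 : ({j, k, i, l} : Finset V) = {i, j, k, l} := by
      ext; simp only [Finset.mem_insert, Finset.mem_singleton]; tauto
    have e4 : ({j, l, i, k} : Finset V) = {i, j, k, l} := by
      ext; simp only [Finset.mem_insert, Finset.mem_singleton]; tauto
    have e5 : ({k, l, i, j} : Finset V) = {i, j, k, l} := by
      ext; simp only [Finset.mem_insert, Finset.mem_singleton]; tauto
    simp only [localWeight, e1, e2, e3, e4, e5]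
    split_ifs
    · rfl
    · simp
  simp only [h0]
  rw [sum_swap_eq fun i j k l => localWeight T r i j k l * (f i - f j) ^ 2, energy]
  simp only [vertexWeight, ← Finset.sum_mul, div_mul_eq_mul_div, ← Finset.sum_div]
  ring

lemma energy_nonneg (hr : r ∈ admissible T) (f : V → ℝ) : 0 ≤ energy (vertexWeight T r) f := by
  classical
  rw [energy_vertexWeight]
  refine div_nonneg (Finset.sum_nonneg fun i _ => Finset.sum_nonneg fun j _ =>
    Finset.sum_nonneg fun k _ => Finset.sum_nonneg fun l _ => ?_) (by norm_num)
  split_ifs with h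
  · exact tetEnergy_nonneg (inv_pos.2 (hr.1 i)) (inv_pos.2 (hr.1 j)) (inv_pos.2 (hr.1 k))
      (inv_pos.2 (hr.1 l)) (kissing_pos hr h) _ _ _ _
  · exact le_rfl

/-- Every tetrahedral term is nonnegative, so all vanish and f is constant on each tetrahedron. Any
two vertices of a face lie in a common tetrahedron, and connectedness does the rest. -/
lemma eq_of_energy_eq_zero [ConnectedSpace M] (hr : r ∈ admissible T) {f : V → ℝ}
    (hf : energy (vertexWeight T r) f = 0) (i j : V) : f i = f j := by
  classical
  have : ConnectedSpace (realization T.toAbstractSimplicialComplex) :=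
    T.homeo.symm.surjective.connectedSpace T.homeo.symm.continuous
  rw [energy_vertexWeight, div_eq_zero_iff, or_iff_left (by norm_num)] at hf
  have hnn (i j k l : V) : 0 ≤ if T.IsTetrahedron {i, j, k, l} then
      tetEnergy (r i)⁻¹ (r j)⁻¹ (r k)⁻¹ (r l)⁻¹ (f i) (f j) (f k) (f l) else 0 := by
    split_ifs with h
    · exact tetEnergy_nonneg (inv_pos.2 (hr.1 i)) (inv_pos.2 (hr.1 j)) (inv_pos.2 (hr.1 k))
        (inv_pos.2 (hr.1 l)) (kissing_pos hr h) _ _ _ _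
    · exact le_rfl
  refine eq_of_connected_realization T.toAbstractSimplicialComplex (f := f) ?_ i j
  intro s hs i hi j hj
  rcases eq_or_ne i j with rfl | hij
  · rfl
  obtain ⟨t, ht, hst, hcard⟩ := T.subset_tetrahedron s hs
  have hsub : ({i, j} : Finset V) ⊆ t := by
    intro x hx
    rcases Finset.mem_insert.1 hx with rfl | hx
    · exact hst hi
    · exact Finset.mem_singleton.1 hx ▸ hst hj
  have h2 : (t \ {i, j}).card = 2 := by
    rw [Finset.card_sdiff_of_subset hsub, hcard, Finset.card_pair hij]
  obtain ⟨k, l, -, hkl⟩ := Finset.card_eq_two.1 h2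
  have heq : t = {i, j, k, l} := by
    rw [← Finset.union_sdiff_of_subset hsub, hkl]
    ext; simp only [Finset.mem_union, Finset.mem_insert, Finset.mem_singleton]; tauto
  have htet : T.IsTetrahedron {i, j, k, l} := heq ▸ ⟨ht, hcard⟩
  have h4 : (if T.IsTetrahedron {i, j, k, l} then
      tetEnergy (r i)⁻¹ (r j)⁻¹ (r k)⁻¹ (r l)⁻¹ (f i) (f j) (f k) (f l) else 0) = 0 := by
    have a1 := (Finset.sum_eq_zero_iff_of_nonneg fun i _ => Finset.sum_nonneg fun j _ =>
      Finset.sum_nonneg fun k _ => Finset.sum_nonneg fun l _ => hnn i j k l).1 hf i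
      (Finset.mem_univ _)
    have a2 := (Finset.sum_eq_zero_iff_of_nonneg fun j _ =>
      Finset.sum_nonneg fun k _ => Finset.sum_nonneg fun l _ => hnn i j k l).1 a1 j
      (Finset.mem_univ _)
    have a3 := (Finset.sum_eq_zero_iff_of_nonneg fun k _ =>
      Finset.sum_nonneg fun l _ => hnn i j k l).1 a2 k (Finset.mem_univ _)
    exact (Finset.sum_eq_zero_iff_of_nonneg fun l _ => hnn i j k l).1 a3 l (Finset.mem_univ _)
  rw [if_pos htet] at h4
  exact eq_of_tetEnergy_eq_zero (inv_pos.2 (hr.1 i)) (inv_pos.2 (hr.1 j)) (inv_pos.2 (hr.1 k))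
        (inv_pos.2 (hr.1 l)) (kissing_pos hr htet) h4

end Curvature

/-! ### Spectral gap, linearization and isolation -/

section Rigidity
variable {V : Type*} [Fintype V] [DecidableEq V] {M : Type*} [TopologicalSpace M]
  {T : Triangulation V M} {r : V → ℝ}

lemma sAlpha_eq [Nonempty V] (hr : r ∈ admissible T) {α c : ℝ}
    (hc : ∀ i, alphaCurvature T α r i = c) : sAlpha T α r = c := by
  have hpos : 0 < ∑ i, r i ^ (α + 1) :=
    Finset.sum_pos (fun i _ => Real.rpow_pos_of_pos (hr.1 i) _) Finset.univ_nonempty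
  rw [sAlpha, reggeFunctional, div_eq_iff hpos.ne', Finset.mul_sum]
  refine Finset.sum_congr rfl fun i _ => ?_
  have hα := (Real.rpow_pos_of_pos (hr.1 i) α).ne'
  rw [← hc i, alphaCurvature, Real.rpow_add (hr.1 i), Real.rpow_one]
  field_simp

/-- The spectral gap condition: the energy of a nonzero function of mean zero exceeds
`c` times its weighted norm. -/
def SpectralGap (T : Triangulation V M) (α : ℝ) (r : V → ℝ) (c : ℝ) : Prop :=
  ∀ g : V → ℝ, ∑ i, r i ^ (α + 1) * g i = 0 →
    energy (vertexWeight T r) g ≤ c * ∑ i, r i ^ (α + 1) * g i ^ 2 → ∀ i, g i = 0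

lemma spectralGap_of_lt_lambdaOne [ConnectedSpace M] (hr : r ∈ admissible T) {α c : ℝ}
    (hc : c < lambdaOne T α r) : SpectralGap T α r c := by
  intro g hg hle
  have hm (i : V) : 0 < r i ^ (α + 1) := Real.rpow_pos_of_pos (hr.1 i) _
  have h1 : lambdaOne T α r * ∑ i, r i ^ (α + 1) * g i ^ 2 ≤ energy (vertexWeight T r) g :=
    sInf_eigenvalue_mul_le_energy vertexWeight_symm hm (rpow_mul_alphaLaplacian hr α)
      (energy_nonneg hr) (fun f hf => eq_of_energy_eq_zero hr hf) hg
  have hnn (i : V) : 0 ≤ r i ^ (α + 1) * g i ^ 2 := mul_nonneg (hm i).le (sq_nonneg _)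
  have h2 : ∑ i, r i ^ (α + 1) * g i ^ 2 = 0 := by
    refine le_antisymm ?_ (Finset.sum_nonneg fun i _ => hnn i)
    by_contra! h
    nlinarith
  intro i
  have h3 := (Finset.sum_eq_zero_iff_of_nonneg fun i _ => hnn i).1 h2 i (Finset.mem_univ i)
  simpa [(hm i).ne'] using h3

/-- Nonnegativity of the energy and its kernel suffice here; positivity of λ₁ need not be
established. -/
lemma spectralGap_of_nonpos [ConnectedSpace M] (hr : r ∈ admissible T) {α c : ℝ}
    (hc : c ≤ 0) : SpectralGap T α r c := by
  intro g hg hle i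
  have hm (i : V) : 0 < r i ^ (α + 1) := Real.rpow_pos_of_pos (hr.1 i) _
  have h1 : 0 ≤ ∑ i, r i ^ (α + 1) * g i ^ 2 :=
    Finset.sum_nonneg fun i _ => mul_nonneg (hm i).le (sq_nonneg _)
  have h2 : energy (vertexWeight T r) g = 0 :=
    le_antisymm (hle.trans (mul_nonpos_of_nonpos_of_nonneg hc h1)) (energy_nonneg hr g)
  have h3 := eq_of_energy_eq_zero hr h2
  have hpos : 0 < ∑ i, r i ^ (α + 1) := Finset.sum_pos (fun i _ => hm i) ⟨i, Finset.mem_univ i⟩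
  simp only [fun j => h3 j i, ← Finset.sum_mul] at hg
  exact (mul_eq_zero.1 hg).resolve_left hpos.ne'

/-- Under the spectral gap condition, the linearized constant curvature equation has no nonzero
solution tangent to the sphere. -/
lemma linearized_injective [Nonempty V] (hr : r ∈ admissible T) {α s σ : ℝ} {v : V → ℝ}
    (hgap : SpectralGap T α r (α * s))
    (hv : ∀ i, curvatureFDeriv T r i v = s * (α * r i ^ (α - 1) * v i) + r i ^ α * σ)
    (hrv : ∑ i, r i * v i = 0) : v = 0 ∧ σ = 0 := by
  set f : V → ℝ := fun i => (r i)⁻¹ * v i with hf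
  have hm (i : V) : 0 < r i ^ (α + 1) := Real.rpow_pos_of_pos (hr.1 i) _
  have hpos : 0 < ∑ i, r i ^ (α + 1) := Finset.sum_pos (fun i _ => hm i) Finset.univ_nonempty
  have heq (i : V) : ∑ j, vertexWeight T r i j * (f i - f j) =
      α * s * (r i ^ (α + 1) * f i) + r i ^ (α + 1) * σ := by
    have h1 := hv i
    have hi := hr.1 i
    rw [curvatureFDeriv_apply, inv_mul_eq_iff_eq_mul₀ hi.ne'] at h1
    rw [h1, hf, Real.rpow_add hi, Real.rpow_sub hi, Real.rpow_one]
    field_simp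
  -- Summing over all vertices annihilates the Laplacian, which determines σ from the weighted mean
  -- c of f. Then f - c solves the eigenvalue equation with value α s.
  have hsum := sum_laplacian (vertexWeight_symm (T := T) (r := r)) f
  simp only [heq, Finset.sum_add_distrib, ← Finset.mul_sum, ← Finset.sum_mul] at hsum
  set c := (∑ i, r i ^ (α + 1) * f i) / ∑ i, r i ^ (α + 1) with hc
  have hcm : ∑ i, r i ^ (α + 1) * f i = c * ∑ i, r i ^ (α + 1) := by
    rw [hc, div_mul_cancel₀ _ hpos.ne']
  have hσ : σ = -(α * s * c) := by
    rw [hcm] at hsum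
    have : (α * s * c + σ) * ∑ i, r i ^ (α + 1) = 0 := by linarith
    linarith [(mul_eq_zero.1 this).resolve_right hpos.ne']
  have hmean : ∑ i, r i ^ (α + 1) * (f i - c) = 0 := by
    simp only [mul_sub, Finset.sum_sub_distrib, ← Finset.sum_mul, hcm]
    ring
  have henergy : energy (vertexWeight T r) (fun i => f i - c) =
      α * s * ∑ i, r i ^ (α + 1) * (f i - c) ^ 2 := by
    rw [← sum_mul_laplacian_self vertexWeight_symm, Finset.mul_sum]
    refine Finset.sum_congr rfl fun i _ => ?_
    simp only [sub_sub_sub_cancel_right, heq, hσ]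
    ring
  have hfc (i : V) : f i = c := sub_eq_zero.1 (hgap _ hmean henergy.le i)
  have hvc (i : V) : v i = c * r i := by
    have h1 := hfc i
    have := (hr.1 i).ne'
    simp only [hf] at h1
    field_simp at h1
    linarith
  have hr2 : 0 < ∑ i, r i ^ 2 := Finset.sum_pos (fun i _ => pow_pos (hr.1 i) 2) Finset.univ_nonempty
  have hc0 : c = 0 := by
    have h1 : c * ∑ i, r i ^ 2 = 0 := by
      rw [← hrv, Finset.mul_sum]
      exact Finset.sum_congr rfl fun i _ => by rw [hvc]; ring
    exact (mul_eq_zero.1 h1).resolve_right hr2.ne'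
  exact ⟨funext fun i => by simp [hvc, hc0], by simp [hσ, hc0]⟩

/-- The constant curvature equation together with the normalization to the unit sphere. -/
noncomputable def curvatureEquation (T : Triangulation V M) (α : ℝ) (p : (V → ℝ) × ℝ) :
    (V → ℝ) × ℝ :=
  (fun i => curvature T p.1 i - p.2 * p.1 i ^ α, ∑ i, p.1 i ^ 2)

lemma exists_hasFDerivAt_curvatureEquation (hr : r ∈ admissible T) (α s : ℝ) :
    ∃ L : (V → ℝ) × ℝ →L[ℝ] (V → ℝ) × ℝ, HasFDerivAt (curvatureEquation T α) L (r, s) ∧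
      ∀ v σ, L (v, σ) = (fun i => curvatureFDeriv T r i v -
        (s * (α * r i ^ (α - 1) * v i) + r i ^ α * σ), 2 * ∑ i, r i * v i) := by
  have hfst : HasFDerivAt (fun p : (V → ℝ) × ℝ => p.1) (ContinuousLinearMap.fst ℝ (V → ℝ) ℝ) (r, s) :=
    hasFDerivAt_fst
  have hcoord (i : V) := (hasFDerivAt_apply (𝕜 := ℝ) i r).comp (r, s) hfst
  have hcurv (i : V) := (hasFDerivAt_curvature hr i).comp (r, s) hfst
  have hsnd : HasFDerivAt (fun p : (V → ℝ) × ℝ => p.2) (ContinuousLinearMap.snd ℝ (V → ℝ) ℝ) (r, s) :=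
    hasFDerivAt_snd
  have h1 (i : V) := (hcurv i).fun_sub
    (hsnd.fun_mul ((hcoord i).rpow_const (p := α) (Or.inl (hr.1 i).ne')))
  have h2 := HasFDerivAt.fun_sum (u := Finset.univ) fun i (_ : i ∈ Finset.univ) => (hcoord i).pow 2
  refine ⟨_, (hasFDerivAt_pi.2 h1).prodMk h2, fun v σ => ?_⟩
  refine Prod.ext (funext fun i => ?_) ?_
  · simp
  · simp [Finset.mul_sum, mul_assoc]

/-- A constant curvature metric satisfying the spectral gap condition is isolated. -/
lemma isIsolatedIn_of_spectralGap {α : ℝ}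
    (hr : r ∈ constantAlphaCurvature T α ∩ unitSphere V)
    (hgap : SpectralGap T α r (α * sAlpha T α r)) :
    IsIsolatedIn r (constantAlphaCurvature T α ∩ unitSphere V) := by
  obtain ⟨⟨hadm, s, hs⟩, hsph⟩ := hr
  rcases isEmpty_or_nonempty V with hV | hV
  · exact ⟨Set.univ, Filter.univ_mem, by
      rw [Set.univ_inter]
      exact Set.eq_singleton_iff_unique_mem.2
        ⟨⟨⟨hadm, s, hs⟩, hsph⟩, fun _ _ => Subsingleton.elim _ _⟩⟩
  rw [sAlpha_eq hadm hs] at hgap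
  obtain ⟨L, hL, hLapply⟩ := exists_hasFDerivAt_curvatureEquation hadm α s
  have hker : L.toLinearMap.ker = ⊥ := by
    rw [LinearMap.ker_eq_bot']
    rintro ⟨v, σ⟩ h0
    have h1 : L (v, σ) = 0 := h0
    rw [hLapply, Prod.ext_iff] at h1
    obtain ⟨rfl, rfl⟩ := linearized_injective hadm hgap
      (fun i => sub_eq_zero.1 (congrFun h1.1 i)) ((mul_eq_zero.1 h1.2).resolve_left two_ne_zero)
    rfl
  -- In finite dimension injectivity of L gives a lower bound on it, so nearby points have a
  -- different image. Differentiability at the single point (r, s) is enough, without an inverse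
  -- function theorem.
  obtain ⟨C, -, hC⟩ := L.toLinearMap.exists_antilipschitzWith hker
  have hne := hL.eventually_ne (c := (0, 1)) ⟨C, hC⟩
  rw [eventually_nhdsWithin_iff] at hne
  have hsol {x : V → ℝ} (hx : x ∈ constantAlphaCurvature T α ∩ unitSphere V) (i : V) :
      curvatureEquation T α (x, alphaCurvature T α x i) = (0, 1) := by
    obtain ⟨⟨hx1, c, hc⟩, hx2⟩ := hx
    refine Prod.ext (funext fun j => ?_) hx2
    have hj := (Real.rpow_pos_of_pos (hx1.1 j) α).ne'
    simp only [curvatureEquation, (hc i).trans (hc j).symm]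
    rw [alphaCurvature, div_mul_cancel₀ _ hj, sub_self]
    rfl
  let i₀ := Classical.arbitrary V
  -- The multiplier of a nearby solution is its curvature at i₀, which is continuous in the metric;
  -- this pulls the neighbourhood of (r, s) back to one of r.
  have hcont : ContinuousAt (fun x => (x, alphaCurvature T α x i₀)) r := by
    refine continuousAt_id.prodMk ?_
    exact (hasFDerivAt_curvature hadm i₀).continuousAt.div
      ((continuousAt_apply i₀ r).rpow_const (Or.inl (hadm.1 i₀).ne'))
      (Real.rpow_pos_of_pos (hadm.1 i₀) α).ne'
  rw [← hs i₀] at hne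
  refine ⟨_, hcont.eventually hne, Set.eq_singleton_iff_unique_mem.2 ⟨⟨?_, ⟨hadm, s, hs⟩, hsph⟩, ?_⟩⟩
  · intro h
    exact absurd rfl h
  · rintro x ⟨hx, hxmem⟩
    by_contra hxr
    exact hx (fun h => hxr (congrArg Prod.fst h)) (hsol hxmem i₀)

end Rigidity

end SpherePacking

theorem mainTheorem6 {V : Type*} [Fintype V] [DecidableEq V]
    {M : Type*} [TopologicalSpace M] [T2Space M] [CompactSpace M] [ConnectedSpace M]
    [ChartedSpace (EuclideanHalfSpace 3) M]
    (T : SpherePacking.Triangulation V M) (α : ℝ) :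
    (∀ r ∈ SpherePacking.constantAlphaCurvature T α ∩ SpherePacking.unitSphere V,
      α * SpherePacking.sAlpha T α r < SpherePacking.lambdaOne T α r →
      SpherePacking.IsIsolatedIn r
        (SpherePacking.constantAlphaCurvature T α ∩ SpherePacking.unitSphere V)) ∧
    (∀ r ∈ SpherePacking.constantAlphaCurvature T α ∩ SpherePacking.unitSphere V,
      α * SpherePacking.sAlpha T α r ≤ 0 →
      SpherePacking.IsIsolatedIn r
        (SpherePacking.constantAlphaCurvature T α ∩ SpherePacking.unitSphere V)) :=
  ⟨fun _ hr h => SpherePacking.isIsolatedIn_of_spectralGap hr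
      (SpherePacking.spectralGap_of_lt_lambdaOne hr.1.1 h),
    fun _ hr h => SpherePacking.isIsolatedIn_of_spectralGap hr
      (SpherePacking.spectralGap_of_nonpos hr.1.1 h)⟩
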